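/- Let $p,n\ge 1$, let $\mathcal S_p(\mathbb R)$ be the space of real symmetric $p\times p$ matrices, with Loewner order, and let $I_p$, $0_p$ be the identity and zero matrix. A (normalized) matrix measure on $[0,1]$ is a $p\times p$ matrix $\mu=(\mu_{i,j})$ of signed Borel measures on $[0,1]$ such that $\mu(A)$ is symmetric and nonnegative definite for every Borel set $A\subset[0,1]$ and $\mu([0,1])=I_p$. Its moments are $S_k=\int_0^1x^k\,d\mu(x)$, and $$\mathcal M_n=\Big\{(S_1,\dots,S_n)\;\Big|\; S_j=\int_0^1x^j\,d\mu(x),\ j=1,\dots,n,\ \mu\text{ a matrix measure on }[0,1]\Big\}\subset(\mathcal S_p(\mathbb R))^n .$$ For $(S_1,\dots,S_n)\in\mathcal M_n$ put $S_0=I_p$ and $D_j=S_j-S_{j+1}$. Define $S_1^-=0_p$, $S_1^+=I_p$, $S_2^+=S_1$ and, for the remaining indices $k\le n$, $$S_{2m}^-=h^T\big(S_{i+j}\big)_{i,j=0}^{m-1}{}^{-1}h,\quad h^T=(S_m,\dots,S_{2m-1});\qquad S_{2m+1}^-=h^T\big(S_{1+i+j}\big)_{i,j=0}^{m-1}{}^{-1}h,\quad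 h^T=(S_{m+1},\dots,S_{2m});$$ $$S_{2m}^+=S_{2m-1}-h^T\big(D_{1+i+j}\big)_{i,j=0}^{m-2}{}^{-1}h,\quad h^T=(D_m,\dots,D_{2m-2});\qquad S_{2m+1}^+=S_{2m}-h^T\big(D_{i+j}\big)_{i,j=0}^{m-1}{}^{-1}h,\quad h^T=(D_m,\dots,D_{2m-1}).$$ The canonical moments are $\bar U_k=(S_k^+-S_k^-)^{-1}(S_k-S_k^-)$, defined whenever $S_k^+-S_k^->0_p$, and $\bar V_k=I_p-\bar U_k$. **Theorem 3.2.** Let $(S_1,\dots,S_n)$ be in the interior of $\mathcal M_n$ in $(\mathcal S_p(\mathbb R))^n$. Then $S_k^+-S_k^->0_p$ for $k=1,\dots,n$, so that the canonical moments $\bar U_1,\dots,\bar U_n$ are defined. Put $\zeta_0=0_p$, $\zeta_1=\bar U_1$ and $\zeta_j=\bar V_{j-1}\bar U_j$ for $j=2,\dots,n$. Then $$S_n=G_{n,n},$$ where the $p\times p$ matrices $G_{i,j}$ are given by $G_{0,j}=I_p$, $G_{i,j}=0_p$ if $i>j$, and $$G_{i,j}=G_{i,j-1}+\zeta_{j-i+1}G_{i-1,j}\qquad\text{for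 } j\ge i\ge1 .$$ In particular, $$S_n=\sum_{(i_1,\dots,i_n)\in I}\zeta_{i_1}\zeta_{i_2}\cdots\zeta_{i_n},$$ where $I=\{(i_1,\dots,i_n)\mid i_k\in\{1,\dots,n\},\ i_1=1,\ i_k\le i_{k-1}+1\ \text{for } 2\le k\le n\}$. -/

import Mathlib

open MeasureTheory

noncomputable section

namespace MatrixMoment

/-- Real `p × p` matrices. -/
abbrev Mat (p : ℕ) : Type := Matrix (Fin p) (Fin p) ℝ

/-- The space of real symmetric `p × p` matrices, with its usual topology
(as a subspace of the space of all matrices). -/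
abbrev SymMat (p : ℕ) : Type := {A : Mat p // A.IsSymm}

/-- A normalized real `p × p` matrix measure on `[0,1]`: a matrix of signed measures such that
`μ(A)` is symmetric and nonnegative definite for each Borel set `A`, and `μ([0,1])` is the
identity matrix. (`Matrix.PosSemidef` includes the symmetry.) -/
structure MatrixMeasure (p : ℕ) where
  /-- the signed measures `μ_{i,j}` -/
  entry : Fin p → Fin p → SignedMeasure (Set.Icc (0 : ℝ) 1)
  posSemidef : ∀ A : Set (Set.Icc (0 : ℝ) 1), MeasurableSet A →
    (Matrix.of fun i j => entry i j A : Mat p).PosSemidef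
  normalized : (Matrix.of fun i j => entry i j Set.univ : Mat p) = 1

/-- The `k`-th moment `∫ x ^ k dμ(x)`, taken entrywise. -/
def MatrixMeasure.moment {p : ℕ} (μ : MatrixMeasure p) (k : ℕ) : Mat p :=
  Matrix.of fun i j => ∫ᵛ x, (x : ℝ) ^ k ∂<•(μ.entry i j)

/-- The `n`-th moment space, a set of points `(S₁, …, Sₙ)` of symmetric matrices; the coordinate
with index `j : Fin n` is `S_{j+1}`. -/
def momentSpace (p n : ℕ) : Set (Fin n → SymMat p) :=
  {s | ∃ μ : MatrixMeasure p, ∀ j : Fin n, (s j : Mat p) = μ.moment (j + 1)}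

/-- The sequence `S₀ = I, S₁, …, Sₙ` of a point `(S₁, …, Sₙ)`; it is continued by `0`, and these
further terms are never used below for canonical moments of order at most `n`. -/
def momentSeq {p n : ℕ} (s : Fin n → SymMat p) : ℕ → Mat p
  | 0 => 1
  | k + 1 => if h : k < n then (s ⟨k, h⟩ : Mat p) else 0

/-- The block Hankel matrix with blocks `a_{t+i+j}`, `0 ≤ i, j < m`. -/
def blockHankel {p : ℕ} (a : ℕ → Mat p) (t m : ℕ) : Matrix (Fin m × Fin p) (Fin m × Fin p) ℝ :=
  Matrix.of fun x y => a (t + x.1 + y.1) x.2 y.2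

/-- The block column with blocks `a_t, …, a_{t+m-1}`. -/
def blockColumn {p : ℕ} (a : ℕ → Mat p) (t m : ℕ) : Matrix (Fin m × Fin p) (Fin p) ℝ :=
  Matrix.of fun x y => a (t + x.1) x.2 y

/-- The matrix `hᵀ H⁻¹ h`, where `H` is the block Hankel matrix with blocks `a_{t+i+j}`
(`0 ≤ i, j < m`) and `h` is the block column with blocks `a_u, …, a_{u+m-1}`.
It is `0` for `m = 0`. -/
def hankelForm {p : ℕ} (a : ℕ → Mat p) (t u m : ℕ) : Mat p :=
  (blockColumn a u m).transpose * (blockHankel a t m)⁻¹ * blockColumn a u m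

/-- The lower bound `S_k⁻` of the `k`-th moment, for `k ≥ 1`:
* `S_{2m}⁻ = hᵀ H⁻¹ h` with `H = (S_{i+j})`, `0 ≤ i, j ≤ m - 1`, and `h = (S_m, …, S_{2m-1})`;
* `S_{2m+1}⁻ = hᵀ H⁻¹ h` with `H = (S_{1+i+j})`, `0 ≤ i, j ≤ m - 1`, and
  `h = (S_{m+1}, …, S_{2m})`; in particular `S_1⁻ = 0`. -/
def lowerMoment {p : ℕ} (S : ℕ → Mat p) (k : ℕ) : Mat p :=
  if Even k then hankelForm S 0 (k / 2) (k / 2) else hankelForm S 1 (k / 2 + 1) (k / 2)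

/-- The upper bound `S_k⁺` of the `k`-th moment, for `k ≥ 1`, with `D_j = S_j - S_{j+1}`:
* `S_{2m}⁺ = S_{2m-1} - hᵀ H⁻¹ h` with `H = (D_{1+i+j})`, `0 ≤ i, j ≤ m - 2`, and
  `h = (D_m, …, D_{2m-2})`; in particular `S_2⁺ = S_1`;
* `S_{2m+1}⁺ = S_{2m} - hᵀ H⁻¹ h` with `H = (D_{i+j})`, `0 ≤ i, j ≤ m - 1`, and
  `h = (D_m, …, D_{2m-1})`; in particular `S_1⁺ = S_0 = I`. -/
def upperMoment {p : ℕ} (S : ℕ → Mat p) (k : ℕ) : Mat p :=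
  S (k - 1) - if Even k then hankelForm (fun j => S j - S (j + 1)) 1 (k / 2) (k / 2 - 1)
    else hankelForm (fun j => S j - S (j + 1)) 0 (k / 2) (k / 2)

/-- The (nonsymmetric) canonical moment `Ū_k = (S_k⁺ - S_k⁻)⁻¹ (S_k - S_k⁻)`, for `k ≥ 1`. -/
def canonicalMoment {p : ℕ} (S : ℕ → Mat p) (k : ℕ) : Mat p :=
  (upperMoment S k - lowerMoment S k)⁻¹ * (S k - lowerMoment S k)

/-- `ζ_0 = 0`, `ζ_1 = Ū_1` and `ζ_j = V̄_{j-1} Ū_j` for `j ≥ 2`, where `V̄_j = I - Ū_j`. -/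
def zeta {p : ℕ} (U : ℕ → Mat p) : ℕ → Mat p
  | 0 => 0
  | 1 => U 1
  | j + 2 => (1 - U (j + 1)) * U (j + 2)

/-- The array `G_{i,j}` with `G_{0,j} = I`, `G_{i,j} = 0` for `i > j`, and
`G_{i,j} = G_{i,j-1} + ζ_{j-i+1} G_{i-1,j}` for `j ≥ i ≥ 1`. -/
def momentArray {p : ℕ} (z : ℕ → Mat p) : ℕ → ℕ → Mat p
  | 0, _ => 1
  | _ + 1, 0 => 0
  | i + 1, j + 1 =>
    if i ≤ j then momentArray z (i + 1) j + z (j - i + 1) * momentArray z i (j + 1) else 0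

/-- The set of all tuples `(i_1, …, i_n)` with `i_k ∈ {1, …, n}`, `i_1 = 1` and
`i_k ≤ i_{k-1} + 1` for `2 ≤ k ≤ n`; the entry `i_k` is stored at the index `k - 1 : Fin n`. -/
def pathSet (n : ℕ) : Finset (Fin n → ℕ) :=
  (Fintype.piFinset fun _ : Fin n => Finset.Icc 1 n).filter fun i =>
    (∀ k : Fin n, (k : ℕ) = 0 → i k = 1) ∧
      ∀ k l : Fin n, (l : ℕ) = (k : ℕ) + 1 → i l ≤ i k + 1

end MatrixMoment

end

/-! ### Unrolling the array `momentArray` into a sum over paths. -/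

namespace MatrixMoment

/-! Let `L_0 = I` and let `L_k = S_k - S_k⁻` be the lower gap of order `k ≥ 1`. A mixing recursion
(`orthPair`) links the monic orthogonal polynomials for the weights `1`, `x`, `1 - x`, `x (1 - x)`,
with matrix coefficients on the left. Eliminating the two families with the factor `1 - x` leaves
monic polynomials `P_d` of degree `d` whose moments `h_d(i) = ∫ x^i P_d` satisfy `h_0(i) = S_i`,
`h_d(0) = L_d` and `h_{d+2}(i) = h_{d+1}(i+1) - L_{d+1} L_d⁻¹ h_d(i+1)`. The canonical moments
satisfy `L_k ζ_{k+1} = L_{k+1}` (`lowerGap_mul_zeta`). Hence `L_d⁻¹ h_d(i)` obeys the recursion of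
`G_{i,d+i}` (`momentArray_eq_inv_mul`), and `d = 0`, `i = n` gives `S_n = G_{n,n}`.

The gaps are Schur complements of block Hankel matrices (`eq_sub_hankelForm`), so their positivity
follows from that of the matrices. An interior point is a proper mixture of a point of the moment
space with the moments of Lebesgue measure times `I`, and the Lebesgue part makes all the quadratic
forms strictly positive. -/

/-- The condition `i_1 ≤ c` and `i_{k+1} ≤ i_k + 1`, on tuples. -/
def IsPathFrom (c : ℕ) {k : ℕ} (i : Fin k → ℕ) : Prop :=
  (∀ a : Fin k, (a : ℕ) = 0 → i a ≤ c) ∧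
    ∀ a b : Fin k, (b : ℕ) = (a : ℕ) + 1 → i b ≤ i a + 1

theorem isPathFrom_cons {c k : ℕ} (l : ℕ) (i : Fin k → ℕ) :
    IsPathFrom c (Fin.cons l i : Fin (k + 1) → ℕ) ↔ l ≤ c ∧ IsPathFrom (l + 1) i := by
  simp only [IsPathFrom, Fin.forall_fin_succ, Fin.cons_zero, Fin.cons_succ, Fin.val_zero,
    Fin.val_succ]
  simp

theorem sum_piFinset_cons {M : Type*} [AddCommMonoid M] (s : Finset ℕ) (k : ℕ)
    (f : (Fin (k + 1) → ℕ) → M) :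
    ∑ i ∈ Fintype.piFinset (fun _ : Fin (k + 1) => s), f i =
      ∑ l ∈ s, ∑ i ∈ Fintype.piFinset (fun _ : Fin k => s), f (Fin.cons l i) := by
  rw [← Finset.sum_product']
  refine Finset.sum_bij' (fun i _ => (i 0, Fin.tail i)) (fun x _ => Fin.cons x.1 x.2) ?_ ?_ ?_ ?_ ?_
  · intro i hi
    simp only [Fintype.mem_piFinset] at hi
    simp [Fintype.mem_piFinset, Fin.tail, hi]
  · intro x hx
    simp only [Finset.mem_product, Fintype.mem_piFinset] at hx
    simp [Fintype.mem_piFinset, Fin.forall_fin_succ, hx.1, hx.2]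
  · intro i _
    simp
  · intro x _
    simp
  · intro i _
    simp

theorem momentArray_eq_zero {p : ℕ} (z : ℕ → Mat p) {i j : ℕ} (h : j < i) :
    momentArray z i j = 0 := by
  cases i with
  | zero => omega
  | succ i =>
    cases j with
    | zero => simp [momentArray]
    | succ j => rw [momentArray, if_neg (by omega)]

theorem momentArray_succ_add {p : ℕ} (z : ℕ → Mat p) (i d : ℕ) :
    momentArray z (i + 1) (d + i + 1) =
      momentArray z (i + 1) (d + i) + z (d + 1) * momentArray z i (d + i + 1) := by
  rw [momentArray, if_pos (by omega), Nat.add_sub_cancel]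

theorem momentArray_succ_eq_sum {p : ℕ} (z : ℕ → Mat p) (i d : ℕ) :
    momentArray z (i + 1) (d + i + 1) =
      ∑ l ∈ Finset.Icc 1 (d + 1), z l * momentArray z i (l + i) := by
  induction d with
  | zero =>
    rw [momentArray_succ_add, momentArray_eq_zero z (by omega)]
    simp [add_comm]
  | succ d ih =>
    rw [momentArray_succ_add, Finset.sum_Icc_succ_top (by omega), ← ih, add_right_comm (d + 1) 1 i,
      add_right_comm d 1 i]

open Classical in
-- The summation index `l` of `momentArray_succ_eq_sum` is the first entry of the path, and the
-- remaining factor `G_{i,l+i}` allows a next entry of at most `l + 1`. The bound `N` only keeps the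
-- index set fixed during the induction.
theorem momentArray_eq_sum_paths {p : ℕ} (z : ℕ → Mat p) (N i d : ℕ) (h : d + i ≤ N) :
    momentArray z i (d + i) =
      ∑ a ∈ Fintype.piFinset (fun _ : Fin i => Finset.Icc 1 N),
        if IsPathFrom (d + 1) a then (List.ofFn fun k : Fin i => z (a k)).prod else 0 := by
  induction i generalizing d with
  | zero => simp [momentArray, IsPathFrom]
  | succ i ih =>
    rw [← add_assoc, momentArray_succ_eq_sum, sum_piFinset_cons]
    have hsub : Finset.Icc 1 (d + 1) ⊆ Finset.Icc 1 N := Finset.Icc_subset_Icc_right (by omega)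
    rw [← Finset.sum_subset hsub]
    · refine Finset.sum_congr rfl fun l hl => ?_
      rw [Finset.mem_Icc] at hl
      rw [ih l (by omega), Finset.mul_sum]
      refine Finset.sum_congr rfl fun a _ => ?_
      by_cases ha : IsPathFrom (l + 1) a <;> simp [isPathFrom_cons, ha, hl.2, List.ofFn_succ]
    · intro l _ hl
      refine Finset.sum_eq_zero fun a _ => if_neg ?_
      rw [isPathFrom_cons]
      rw [Finset.mem_Icc] at hl
      simp only [Finset.mem_Icc] at *
      omega

theorem momentArray_self_eq_sum_pathSet {p : ℕ} (z : ℕ → Mat p) (n : ℕ) :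
    momentArray z n n = ∑ i ∈ pathSet n, (List.ofFn fun k : Fin n => z (i k)).prod := by
  classical
  have h := momentArray_eq_sum_paths z n n 0 (by omega)
  rw [zero_add] at h
  rw [h, pathSet, ← Finset.sum_filter]
  refine Finset.sum_congr (Finset.filter_congr fun a ha => ?_) fun _ _ => rfl
  simp only [Fintype.mem_piFinset, Finset.mem_Icc] at ha
  -- The entries are at least `1`, so a first entry `≤ 1` is the same as a first entry `= 1`.
  refine and_congr_left fun _ => forall_congr' fun k => imp_congr_right fun _ => ?_
  have := (ha k).1
  omega

end MatrixMoment

/-! ### Recursion for the orthogonal polynomials and their gaps. -/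

namespace MatrixMoment

/-- The pairs `(⟨P, x ^ ·⟩, ⟨Q, x ^ ·⟩)` of moment sequences of the monic orthogonal polynomials for
consecutive members of the four families of weights `1`, `x`, `1 - x`, `x (1 - x)`, with
exponents shifted by the degrees. -/
noncomputable def orthPair {p : ℕ} (T : ℤ → Mat p) : ℕ → (ℤ → Mat p) × (ℤ → Mat p)
  | 0 => (fun i => T (i + 1), T)
  | k + 1 =>
    let u := (orthPair T k).1
    let v := (orthPair T k).2
    let b := u 0 * (u 0 + (v 0 - v 1))⁻¹
    (fun i => (1 - b) * u (i + 1) + b * v (i + 1 + 1) - b * v (i + 1),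
      fun i => (1 - b) * u i + b * v (i + 1))

variable {p : ℕ} (T : ℤ → Mat p)

/-- The distance of the moment of order `k + 1` from its lower bound. -/
noncomputable def lowerGap (k : ℕ) : Mat p := (orthPair T k).1 0

/-- The distance of the moment of order `k + 1` from its upper bound. -/
noncomputable def upperGap (k : ℕ) : Mat p := (orthPair T k).2 0 - (orthPair T k).2 1

/-- The relative position of the moment of order `k + 1` in its range, normalized on the right. -/
noncomputable def gapRatio (k : ℕ) : Mat p := lowerGap T k * (lowerGap T k + upperGap T k)⁻¹

theorem orthPair_succ_snd (k : ℕ) (i : ℤ) : (orthPair T (k + 1)).2 i =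
    (1 - gapRatio T k) * (orthPair T k).1 i + gapRatio T k * (orthPair T k).2 (i + 1) := rfl

theorem orthPair_succ_fst (k : ℕ) (i : ℤ) : (orthPair T (k + 1)).1 i =
    (orthPair T (k + 1)).2 (i + 1) - gapRatio T k * (orthPair T k).2 (i + 1) := rfl

theorem orthPair_succ_fst_add (k : ℕ) (i : ℤ) :
    (orthPair T (k + 1)).1 i + ((orthPair T (k + 1)).2 i - (orthPair T (k + 1)).2 (i + 1)) =
      (1 - gapRatio T k) * (orthPair T k).1 i := by
  rw [orthPair_succ_fst, orthPair_succ_snd T k i]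
  abel

/-- This eliminates the second components, which belong to the weights with the factor `1 - x`. -/
theorem orthPair_three_term (k : ℕ) (i : ℤ) :
    (orthPair T (k + 2)).1 i = (orthPair T (k + 1)).1 (i + 1) -
      gapRatio T (k + 1) * (1 - gapRatio T k) * (orthPair T k).1 (i + 1) := by
  rw [mul_assoc, ← orthPair_succ_fst_add, orthPair_succ_fst, orthPair_succ_snd]
  noncomm_ring

theorem lowerGap_add_upperGap_succ (k : ℕ) :
    lowerGap T (k + 1) + upperGap T (k + 1) = (1 - gapRatio T k) * lowerGap T k :=
  orthPair_succ_fst_add T k 0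

theorem lowerGap_add_upperGap_zero : lowerGap T 0 + upperGap T 0 = T 0 := by
  simp [lowerGap, upperGap, orthPair]

theorem one_sub_gapRatio_mul_lowerGap (k : ℕ) (h : IsUnit (lowerGap T k + upperGap T k).det) :
    (1 - gapRatio T k) * lowerGap T k = gapRatio T k * upperGap T k := by
  have : gapRatio T k * (lowerGap T k + upperGap T k) = lowerGap T k := by
    rw [gapRatio, Matrix.mul_assoc, Matrix.nonsing_inv_mul _ h, Matrix.mul_one]
  rw [sub_mul, one_mul, sub_eq_iff_eq_add, add_comm, ← mul_add, this]

/-- Orthogonality of the polynomials underlying `orthPair`. -/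
theorem orthPair_orth (k : ℕ) (h : ∀ j < k, IsUnit (lowerGap T j + upperGap T j).det) :
    (∀ i : ℤ, -((k + 1) / 2 : ℕ) ≤ i → i < 0 → (orthPair T k).1 i = 0) ∧
      ∀ i : ℤ, -(k / 2 : ℕ) ≤ i → i < 0 → (orthPair T k).2 i - (orthPair T k).2 (i + 1) = 0 := by
  induction k with
  | zero => constructor <;> intro i h1 h2 <;> simp at h1 <;> omega
  | succ k ih =>
    obtain ⟨hu, hv⟩ := ih fun j hj => h j (by omega)
    have hk := one_sub_gapRatio_mul_lowerGap T k (h k (by omega))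
    -- At `i = -1` this is the equation that determines the mixing ratio; for smaller `i` both sides
    -- vanish by induction.
    have key : ∀ i : ℤ, -(k / 2 : ℕ) ≤ i + 1 → i < 0 →
        (1 - gapRatio T k) * (orthPair T k).1 (i + 1) =
          gapRatio T k * ((orthPair T k).2 (i + 1) - (orthPair T k).2 (i + 1 + 1)) := by
      intro i h1 h2
      rcases eq_or_ne i (-1) with rfl | hi
      · exact hk
      · rw [hu _ (by omega) (by omega), hv _ (by omega) (by omega), mul_zero, mul_zero]
    constructor
    · intro i h1 h2
      rw [orthPair_succ_fst, orthPair_succ_snd, key i (by omega) h2]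
      noncomm_ring
    · intro i h1 h2
      have := key i (by omega) h2
      rw [orthPair_succ_snd, orthPair_succ_snd, hu i (by omega) h2, this]
      noncomm_ring

/-- `f` is the moment sequence of a monic polynomial of degree `top` divisible by `x ^ lo`. -/
def IsMonicComb (lo top : ℕ) (f : ℤ → Mat p) : Prop :=
  ∃ c : ℕ → Mat p, ∀ i : ℤ,
    f i = T (top + i) + ∑ r ∈ Finset.Ico lo top, c r * T (r + i)

variable {T}

theorem IsMonicComb.mono {lo lo' top : ℕ} {f : ℤ → Mat p} (h : lo' ≤ lo)
    (hf : IsMonicComb T lo top f) : IsMonicComb T lo' top f := by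
  obtain ⟨c, hc⟩ := hf
  refine ⟨fun r => if lo ≤ r then c r else 0, fun i => ?_⟩
  rw [hc i]
  congr 1
  rw [← Finset.sum_subset (Finset.Ico_subset_Ico_left h : Finset.Ico lo top ⊆ _)]
  · refine Finset.sum_congr rfl fun r hr => ?_
    simp only [if_pos (Finset.mem_Ico.1 hr).1]
  · intro r hr hr'
    rw [Finset.mem_Ico] at hr hr'
    simp only [if_neg (show ¬lo ≤ r by omega), zero_mul]

theorem IsMonicComb.shift {lo top : ℕ} {f : ℤ → Mat p} (hf : IsMonicComb T lo top f) :
    IsMonicComb T (lo + 1) (top + 1) fun i => f (i + 1) := by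
  obtain ⟨c, hc⟩ := hf
  refine ⟨fun r => c (r - 1), fun i => ?_⟩
  simp only [hc]
  rw [← Finset.sum_Ico_add' _ lo top 1]
  simp only [Nat.add_sub_cancel]
  push_cast
  congr 1
  · congr 1; ring
  · refine Finset.sum_congr rfl fun r _ => ?_
    congr 2; ring

theorem IsMonicComb.combine {lo top : ℕ} {f g : ℤ → Mat p} (b : Mat p)
    (hf : IsMonicComb T lo top f) (hg : IsMonicComb T lo top g) :
    IsMonicComb T lo top fun i => (1 - b) * f i + b * g i := by
  obtain ⟨c, hc⟩ := hf
  obtain ⟨d, hd⟩ := hg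
  refine ⟨fun r => (1 - b) * c r + b * d r, fun i => ?_⟩
  simp only [hc, hd, mul_add, add_mul, Finset.sum_add_distrib, Finset.mul_sum, mul_assoc]
  rw [sub_mul, one_mul]
  abel

theorem IsMonicComb.sub_mul {lo top : ℕ} {f g : ℤ → Mat p} (b : Mat p) (h : lo ≤ top)
    (hf : IsMonicComb T lo (top + 1) f) (hg : IsMonicComb T lo top g) :
    IsMonicComb T lo (top + 1) fun i => f i - b * g i := by
  obtain ⟨c, hc⟩ := hf
  obtain ⟨d, hd⟩ := hg
  -- The leading term of `g` has degree `top`, so it enters the lower coefficients of the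
  -- difference.
  refine ⟨fun r => c r - b * (if r = top then 1 else d r), fun i => ?_⟩
  have : ∑ r ∈ Finset.Ico lo top, (c r - b * if r = top then 1 else d r) * T (r + i) =
      ∑ r ∈ Finset.Ico lo top, (c r * T (r + i) - b * (d r * T (r + i))) := by
    refine Finset.sum_congr rfl fun r hr => ?_
    rw [if_neg (Finset.mem_Ico.1 hr).2.ne, _root_.sub_mul, mul_assoc]
  simp only [hc, hd]
  rw [Finset.sum_Ico_succ_top h, Finset.sum_Ico_succ_top h, this, Finset.sum_sub_distrib,
    ← Finset.mul_sum]
  simp only [if_true]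
  noncomm_ring

/-- The weights `1 - b` and `b` sum to `1`, so mixing keeps the polynomial monic. The power of `x`
that divides it ensures that negative shifts later reach only genuine moments. -/
theorem orthPair_isMonicComb (T : ℤ → Mat p) (k : ℕ) :
    IsMonicComb T (k / 2 + 1) (k + 1) (orthPair T k).1 ∧
      IsMonicComb T ((k + 1) / 2) k (orthPair T k).2 := by
  induction k with
  | zero =>
    refine ⟨⟨0, fun i => ?_⟩, ⟨0, fun i => ?_⟩⟩
    · simp [orthPair, add_comm]
    · simp [orthPair]
  | succ k ih =>
    obtain ⟨hu, hv⟩ := ih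
    have hv' : IsMonicComb T ((k + 1 + 1) / 2) (k + 1) (orthPair T (k + 1)).2 :=
      (hu.mono (by omega)).combine (gapRatio T k) (hv.shift.mono (by omega))
    exact ⟨(hv'.shift.mono (by omega)).sub_mul (gapRatio T k) (by omega) (hv.shift.mono (by omega)),
      hv'⟩

/-- The total gap at `k + 1` is `(1 - b_k) L_k`, so its inverse ends in `(1 - b_k)⁻¹`, which
cancels. -/
theorem gapRatio_succ_mul (T : ℤ → Mat p) (k : ℕ)
    (h1 : IsUnit (lowerGap T (k + 1) + upperGap T (k + 1)).det) :
    gapRatio T (k + 1) * (1 - gapRatio T k) = lowerGap T (k + 1) * (lowerGap T k)⁻¹ := by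
  rw [gapRatio, lowerGap_add_upperGap_succ, Matrix.mul_inv_rev, mul_assoc, mul_assoc,
    Matrix.nonsing_inv_mul, Matrix.mul_one]
  rw [lowerGap_add_upperGap_succ, Matrix.det_mul] at h1
  exact isUnit_of_mul_isUnit_left h1

/-- `L_k ζ_{k+1} = L_{k+1}`. -/
theorem lowerGap_mul_zeta (T : ℤ → Mat p) (k : ℕ)
    (h1 : IsUnit (lowerGap T (k + 1) + upperGap T (k + 1)).det) :
    lowerGap T k * ((1 - (lowerGap T k + upperGap T k)⁻¹ * lowerGap T k) *
      ((lowerGap T (k + 1) + upperGap T (k + 1))⁻¹ * lowerGap T (k + 1))) =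
      lowerGap T (k + 1) := by
  have : lowerGap T k * (1 - (lowerGap T k + upperGap T k)⁻¹ * lowerGap T k) =
      lowerGap T (k + 1) + upperGap T (k + 1) := by
    rw [lowerGap_add_upperGap_succ, gapRatio]
    noncomm_ring
  rw [← mul_assoc, this, ← mul_assoc, Matrix.mul_nonsing_inv _ h1, one_mul]

/-- After multiplication by `(L (d + 1))⁻¹` on the left, `hrec` becomes the defining recursion of
the array, because `z (d + 1) * (L (d + 1))⁻¹ = (L d)⁻¹`. -/
theorem momentArray_eq_inv_mul {n : ℕ} (z : ℕ → Mat p) (L : ℕ → Mat p) (h : ℕ → ℤ → Mat p)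
    (hL : ∀ d ≤ n, IsUnit (L d).det) (hz : ∀ d, d + 1 ≤ n → L d * z (d + 1) = L (d + 1))
    (h_zero : ∀ d, h d 0 = L d) (h_one : ∀ i, h 0 (i + 1) = h 1 i)
    (hrec : ∀ d i, d + 2 ≤ n →
      h (d + 1) (i + 1) = h (d + 2) i + L (d + 1) * (L d)⁻¹ * h d (i + 1))
    (i d : ℕ) (hd : d + i ≤ n) : momentArray z i (d + i) = (L d)⁻¹ * h d i := by
  have hinv : ∀ d, d + 1 ≤ n → z (d + 1) * (L (d + 1))⁻¹ = (L d)⁻¹ := by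
    intro d hd
    rw [← hz d hd, Matrix.mul_inv_rev, ← mul_assoc, Matrix.mul_nonsing_inv, one_mul]
    have := hL (d + 1) hd
    rw [← hz d hd, Matrix.det_mul] at this
    exact isUnit_of_mul_isUnit_right this
  induction i generalizing d with
  | zero =>
    rw [momentArray, Nat.cast_zero, h_zero, Matrix.nonsing_inv_mul _ (hL d (by omega))]
  | succ i ih =>
    have hcol : ∀ d, d + (i + 1) ≤ n → z (d + 1) * momentArray z i (d + i + 1) =
        (L d)⁻¹ * h (d + 1) i := by
      intro d hd
      rw [add_right_comm, ih (d + 1) (by omega), ← mul_assoc, hinv d (by omega)]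
    induction d with
    | zero =>
      rw [← add_assoc, momentArray_succ_add, momentArray_eq_zero z (by omega), zero_add,
        hcol 0 hd, Nat.cast_succ, h_one]
    | succ d ihd =>
      rw [← add_assoc, momentArray_succ_add, hcol (d + 1) hd, add_right_comm d 1 i, add_assoc d i 1,
        ihd (by omega), Nat.cast_succ, hrec d i (by omega), mul_add, ← mul_assoc, ← mul_assoc,
        Matrix.nonsing_inv_mul _ (hL _ (by omega)), one_mul, add_comm]

end MatrixMoment

/-! ### Gaps as Schur complements of block Hankel matrices. -/

namespace MatrixMoment

variable {p : ℕ}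

theorem blockHankel_isSymm {a : ℕ → Mat p} (ha : ∀ k, (a k).IsSymm) (t m : ℕ) :
    (blockHankel a t m).IsSymm := by
  ext x y
  simp only [Matrix.transpose_apply, blockHankel, Matrix.of_apply]
  rw [add_right_comm]
  exact (ha _).apply _ _

/-- The coefficients of a monic orthogonal polynomial solve a block Hankel system. -/
theorem sum_mul_eq_neg_hankelForm {a : ℕ → Mat p} (ha : ∀ k, (a k).IsSymm) {t u m : ℕ}
    (hH : IsUnit (blockHankel a t m).det) (c : Fin m → Mat p)
    (hc : ∀ y : Fin m, a (u + y) + ∑ x, c x * a (t + x + y) = 0) :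
    ∑ x : Fin m, c x * a (u + x) = -hankelForm a t u m := by
  -- The coefficients act from the left, so they form a block row `C` with `C H = -hᵀ`; symmetry of
  -- the blocks identifies the right side with a transposed column.
  let C : Matrix (Fin p) (Fin m × Fin p) ℝ := Matrix.of fun b x => c x.1 b x.2
  have h1 : C * blockHankel a t m = -(blockColumn a u m).transpose := by
    ext b y
    have := congrFun (congrFun (hc y.1) b) y.2
    simp only [Matrix.add_apply, Matrix.sum_apply, Matrix.mul_apply, Matrix.zero_apply] at this
    simp only [Matrix.mul_apply, Matrix.neg_apply, Matrix.transpose_apply, blockColumn, C,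
      Matrix.of_apply, blockHankel, Fintype.sum_prod_type]
    rw [(ha (u + y.1)).apply]
    linarith
  have h2 : C = -((blockColumn a u m).transpose * (blockHankel a t m)⁻¹) := by
    rw [← Matrix.neg_mul, ← h1, Matrix.mul_assoc, Matrix.mul_nonsing_inv _ hH, Matrix.mul_one]
  have h3 : ∑ x : Fin m, c x * a (u + x) = C * blockColumn a u m := by
    ext b d
    simp [Matrix.sum_apply, Matrix.mul_apply, blockColumn, C, Fintype.sum_prod_type]
  rw [h3, h2, Matrix.neg_mul, hankelForm]

/-- The equivalence splitting off the last block. -/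
def lastBlockEquiv (m p : ℕ) : (Fin m × Fin p) ⊕ Fin p ≃ Fin (m + 1) × Fin p where
  toFun := Sum.elim (fun x => (x.1.castSucc, x.2)) fun b => (Fin.last m, b)
  invFun x := Fin.lastCases (motive := fun _ => (Fin m × Fin p) ⊕ Fin p) (Sum.inr x.2)
    (fun i => Sum.inl (i, x.2)) x.1
  left_inv x := by rcases x with x | b <;> simp
  right_inv x := by
    rcases x with ⟨i, b⟩
    induction i using Fin.lastCases <;> simp

theorem blockHankel_succ_submatrix {a : ℕ → Mat p} (ha : ∀ k, (a k).IsSymm) (t m : ℕ) :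
    (blockHankel a t (m + 1)).submatrix (lastBlockEquiv m p) (lastBlockEquiv m p) =
      Matrix.fromBlocks (blockHankel a t m) (blockColumn a (t + m) m)
        (blockColumn a (t + m) m).conjTranspose (a (t + m + m)) := by
  ext x y
  rcases x with x | b <;> rcases y with y | d
  · simp [lastBlockEquiv, blockHankel]
  · simp [lastBlockEquiv, blockHankel, blockColumn, add_right_comm]
  · simp [lastBlockEquiv, blockHankel, blockColumn, (ha _).apply]
  · simp [lastBlockEquiv, blockHankel]

theorem blockHankel_posDef_of_succ {a : ℕ → Mat p} {t m : ℕ}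
    (h : (blockHankel a t (m + 1)).PosDef) : (blockHankel a t m).PosDef := by
  have h1 := h.submatrix (e := fun x : Fin m × Fin p => lastBlockEquiv m p (Sum.inl x))
    ((lastBlockEquiv m p).injective.comp Sum.inl_injective)
  convert! h1 using 1

/-- The Schur complement of a positive definite block Hankel matrix. -/
theorem posDef_sub_hankelForm {a : ℕ → Mat p} (ha : ∀ k, (a k).IsSymm) {t m : ℕ}
    (h : (blockHankel a t (m + 1)).PosDef) :
    (a (t + m + m) - hankelForm a t (t + m) m).PosDef := by
  have hH := blockHankel_posDef_of_succ h
  have hB := h.submatrix (lastBlockEquiv m p).injective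
  rw [blockHankel_succ_submatrix ha] at hB
  let := hH.isUnit.invertible
  have hS := (Matrix.PosDef.fromBlocks₁₁ _ _ hH).1 hB.posSemidef
  -- The block criterion gives only semidefiniteness; the determinant factorization makes the Schur
  -- complement invertible, hence definite.
  have hdet := hB.isUnit
  rw [Matrix.isUnit_iff_isUnit_det, Matrix.det_fromBlocks₁₁] at hdet
  have hdet' := isUnit_of_mul_isUnit_right hdet
  rw [Matrix.invOf_eq_nonsing_inv, ← Matrix.isUnit_iff_isUnit_det] at hdet'
  exact hS.posDef_iff_isUnit.2 hdet'

/-- Orthogonality is a block linear system for the lower coefficients, and solving it turns `f 0`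
into a Schur complement. Since `lo = t + m`, shifts down to `-m` use no negative index, and the
values of `a'` there are irrelevant. -/
theorem eq_sub_hankelForm {a : ℕ → Mat p} (ha : ∀ k, (a k).IsSymm) {t m : ℕ}
    (hH : IsUnit (blockHankel a t m).det) {a' f : ℤ → Mat p} (ha' : ∀ j : ℕ, a' j = a j)
    (hf : IsMonicComb a' (t + m) (t + m + m) f) (h0 : ∀ i : ℤ, -m ≤ i → i < 0 → f i = 0) :
    f 0 = a (t + m + m) - hankelForm a t (t + m) m := by
  obtain ⟨c, hc⟩ := hf
  have hsum : ∀ i : ℤ, f i =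
      a' ((t + m + m : ℕ) + i) + ∑ x : Fin m, c (t + m + x) * a' ((t + m + x : ℕ) + i) := by
    intro i
    rw [hc, Finset.sum_Ico_eq_sum_range, Nat.add_sub_cancel_left, Finset.sum_range]
  have key := sum_mul_eq_neg_hankelForm ha (u := t + m) hH (fun x => c (t + m + x)) fun y => by
    have h1 := hsum (y - m)
    rw [h0 _ (by omega) (by omega)] at h1
    rw [h1, ← ha']
    congr 1
    · congr 1; push_cast; ring
    · refine Finset.sum_congr rfl fun x _ => ?_
      rw [← ha']
      congr 2; push_cast; ring
  rw [hsum, sub_eq_add_neg, ← key]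
  simp only [add_zero, ha']

/-- The extension of a sequence to negative indices used for the shifted polynomials. -/
def intExt (S : ℕ → Mat p) (i : ℤ) : Mat p := S i.toNat

theorem lowerMoment_eq (S : ℕ → Mat p) (k : ℕ) : lowerMoment S (k + 1) =
    hankelForm S ((k + 1) % 2) ((k + 1) % 2 + (k + 1) / 2) ((k + 1) / 2) := by
  unfold lowerMoment
  split_ifs with h
  · rw [Nat.even_iff.1 h, zero_add]
  · rw [Nat.not_even_iff.1 h, add_comm]

theorem upperMoment_eq (S : ℕ → Mat p) (k : ℕ) : upperMoment S (k + 1) =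
    S k - hankelForm (fun j => S j - S (j + 1)) (k % 2) (k % 2 + k / 2) (k / 2) := by
  unfold upperMoment
  rw [Nat.add_sub_cancel]
  split_ifs with h
  · rw [Nat.even_add_one, Nat.not_even_iff] at h
    rw [h, show (k + 1) / 2 = 1 + k / 2 by omega, show 1 + k / 2 - 1 = k / 2 by omega]
  · rw [Nat.even_add_one, not_not, Nat.even_iff] at h
    rw [h, show (k + 1) / 2 = k / 2 by omega, zero_add]

theorem lowerGap_eq {S : ℕ → Mat p} (hS : ∀ k, (S k).IsSymm) (k : ℕ)
    (hu : ∀ j < k, IsUnit (lowerGap (intExt S) j + upperGap (intExt S) j).det)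
    (hH : IsUnit (blockHankel S ((k + 1) % 2) ((k + 1) / 2)).det) :
    lowerGap (intExt S) k = S (k + 1) - lowerMoment S (k + 1) := by
  have h := eq_sub_hankelForm hS hH (a' := intExt S) (f := (orthPair (intExt S) k).1)
    (fun j => rfl) ?_ fun i h1 h2 => (orthPair_orth _ k hu).1 i h1 h2
  · rw [lowerGap, h, lowerMoment_eq]
    congr 2
    omega
  · have := (orthPair_isMonicComb (intExt S) k).1
    convert this using 1 <;> omega

/-- Differencing multiplies the measure by `1 - x` and keeps the polynomial, so upper gaps reduce to
the Schur complement computation for `D_j`. -/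
theorem IsMonicComb.sub_shift {T : ℤ → Mat p} {lo top : ℕ} {f : ℤ → Mat p}
    (hf : IsMonicComb T lo top f) :
    IsMonicComb (fun i => T i - T (i + 1)) lo top fun i => f i - f (i + 1) := by
  obtain ⟨c, hc⟩ := hf
  refine ⟨c, fun i => ?_⟩
  simp only [hc, mul_sub, Finset.sum_sub_distrib, add_assoc]
  abel

theorem upperGap_eq {S : ℕ → Mat p} (hS : ∀ k, (S k).IsSymm) (k : ℕ)
    (hu : ∀ j < k, IsUnit (lowerGap (intExt S) j + upperGap (intExt S) j).det)
    (hH : IsUnit (blockHankel (fun j => S j - S (j + 1)) (k % 2) (k / 2)).det) :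
    upperGap (intExt S) k = upperMoment S (k + 1) - S (k + 1) := by
  have h := eq_sub_hankelForm (a := fun j => S j - S (j + 1)) (fun j => (hS j).sub (hS (j + 1))) hH
    (a' := fun i => intExt S i - intExt S (i + 1))
    (f := fun i => (orthPair (intExt S) k).2 i - (orthPair (intExt S) k).2 (i + 1))
    (fun j => rfl) ?_ fun i h1 h2 => (orthPair_orth _ k hu).2 i h1 h2
  · rw [upperMoment_eq, sub_right_comm]
    refine h.trans ?_
    congr 2 <;> congr 1 <;> omega
  · have := (orthPair_isMonicComb (intExt S) k).2.sub_shift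
    convert this using 1 <;> omega

/-- Positive definiteness of the block Hankel matrices up to order `n` gives the strict
inequalities for the moments up to order `n`. -/
theorem gaps_of_posDef {S : ℕ → Mat p} (hS : ∀ k, (S k).IsSymm) {n : ℕ}
    (hl : ∀ k, k < n → (blockHankel S ((k + 1) % 2) ((k + 1) / 2 + 1)).PosDef)
    (hr : ∀ k, k < n →
      (blockHankel (fun j => S j - S (j + 1)) (k % 2) (k / 2 + 1)).PosDef)
    (k : ℕ) (hk : k < n) :
    lowerGap (intExt S) k = S (k + 1) - lowerMoment S (k + 1) ∧
      upperGap (intExt S) k = upperMoment S (k + 1) - S (k + 1) ∧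
      (lowerGap (intExt S) k).PosDef ∧ (upperGap (intExt S) k).PosDef := by
  induction k using Nat.strong_induction_on with
  | _ k ih =>
    have hD : ∀ j, (S j - S (j + 1)).IsSymm := fun j => (hS j).sub (hS (j + 1))
    -- Orthogonality at order `k` needs all earlier total gaps invertible, hence the strong
    -- induction.
    have hu : ∀ j < k, IsUnit (lowerGap (intExt S) j + upperGap (intExt S) j).det := by
      intro j hj
      obtain ⟨_, _, h1, h2⟩ := ih j hj (by omega)
      exact (Matrix.isUnit_iff_isUnit_det _).1 (h1.add h2).isUnit
    have e1 := lowerGap_eq hS k hu ((Matrix.isUnit_iff_isUnit_det _).1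
      (blockHankel_posDef_of_succ (hl k hk)).isUnit)
    have e2 := upperGap_eq hS k hu ((Matrix.isUnit_iff_isUnit_det _).1
      (blockHankel_posDef_of_succ (hr k hk)).isUnit)
    refine ⟨e1, e2, ?_, ?_⟩
    · have := posDef_sub_hankelForm hS (hl k hk)
      rw [e1, lowerMoment_eq]
      convert this using 3
      omega
    · have := posDef_sub_hankelForm hD (hr k hk)
      rw [e2, upperMoment_eq, sub_right_comm]
      convert this using 2
      congr 2 <;> [skip; congr 1] <;> omega

theorem moment_eq_momentArray {S : ℕ → Mat p} (hS : ∀ k, (S k).IsSymm) (hS0 : S 0 = 1) {n : ℕ}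
    (hl : ∀ k, k < n → (blockHankel S ((k + 1) % 2) ((k + 1) / 2 + 1)).PosDef)
    (hr : ∀ k, k < n →
      (blockHankel (fun j => S j - S (j + 1)) (k % 2) (k / 2 + 1)).PosDef) :
    S n = momentArray (zeta (canonicalMoment S)) n n := by
  have hg := gaps_of_posDef hS hl hr
  have hsum : ∀ k < n, upperMoment S (k + 1) - lowerMoment S (k + 1) =
      lowerGap (intExt S) k + upperGap (intExt S) k := by
    intro k hk
    rw [(hg k hk).1, (hg k hk).2.1]
    abel
  have hU : ∀ k < n, canonicalMoment S (k + 1) =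
      (lowerGap (intExt S) k + upperGap (intExt S) k)⁻¹ * lowerGap (intExt S) k := by
    intro k hk
    rw [canonicalMoment, hsum k hk, ← (hg k hk).1]
  have hunit : ∀ k < n, IsUnit (lowerGap (intExt S) k + upperGap (intExt S) k).det := by
    intro k hk
    exact (Matrix.isUnit_iff_isUnit_det _).1 ((hg k hk).2.2.1.add (hg k hk).2.2.2).isUnit
  -- Index `0` is filled by `1` and by the moments themselves, which shifts the gaps by one and
  -- makes `ζ_1 = Ū_1` fit the pattern.
  let L : ℕ → Mat p := fun d => Nat.casesOn d 1 (lowerGap (intExt S))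
  let h : ℕ → ℤ → Mat p := fun d => Nat.casesOn d (intExt S) fun k => (orthPair (intExt S) k).1
  have hLu : ∀ d ≤ n, IsUnit (L d).det := by
    intro d hd
    cases d with
    | zero => simp [L]
    | succ k => exact (Matrix.isUnit_iff_isUnit_det _).1 (hg k hd).2.2.1.isUnit
  have hdet0 : lowerGap (intExt S) 0 + upperGap (intExt S) 0 = 1 := by
    rw [lowerGap_add_upperGap_zero]
    exact hS0
  have key := momentArray_eq_inv_mul (n := n) (zeta (canonicalMoment S)) L h hLu ?_ ?_ ?_ ?_ n 0
    (by omega)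
  · rw [zero_add] at key
    rw [key]
    simp [L, h, intExt]
  · intro d hd
    cases d with
    | zero =>
      change 1 * canonicalMoment S 1 = lowerGap (intExt S) 0
      rw [hU 0 hd, hdet0]
      simp
    | succ k =>
      change lowerGap (intExt S) k *
        ((1 - canonicalMoment S (k + 1)) * canonicalMoment S (k + 1 + 1)) = _
      rw [hU k (by omega), hU (k + 1) hd, lowerGap_mul_zeta _ _ (hunit _ hd)]
  · intro d
    cases d with
    | zero => exact hS0
    | succ k => rfl
  · intro i
    rfl
  · intro d i hd
    cases d with
    | zero =>
      change (orthPair (intExt S) 0).1 (i + 1) = (orthPair (intExt S) 1).1 i +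
        lowerGap (intExt S) 0 * 1⁻¹ * intExt S (i + 1)
      rw [orthPair_succ_fst, orthPair_succ_snd, gapRatio, hdet0]
      simp only [orthPair, inv_one]
      noncomm_ring
    | succ k =>
      change (orthPair (intExt S) (k + 1)).1 (i + 1) = (orthPair (intExt S) (k + 2)).1 i +
        lowerGap (intExt S) (k + 1) * (lowerGap (intExt S) k)⁻¹ * (orthPair (intExt S) k).1 (i + 1)
      rw [orthPair_three_term, gapRatio_succ_mul _ _ (hunit _ (by omega))]
      abel

end MatrixMoment

/-! ### Positive definiteness at interior points. -/

namespace MatrixMoment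

open Polynomial Filter Topology

variable {p : ℕ}

theorem quadraticForm_blockHankel (Λ : Fin p → Fin p → ℝ[X] →ₗ[ℝ] ℝ) (w : ℝ[X]) {a : ℕ → Mat p}
    {t m : ℕ} (ha : ∀ x y : Fin m, ∀ b c, a (t + x + y) b c = Λ b c (X ^ (t + x + y : ℕ) * w))
    (v : Fin m × Fin p → ℝ) :
    star v ⬝ᵥ (Matrix.mulVec (blockHankel a t m) v) =
      ∑ b, ∑ c, Λ b c (X ^ t * w * (∑ x : Fin m, C (v (x, b)) * X ^ (x : ℕ)) *
        (∑ x : Fin m, C (v (x, c)) * X ^ (x : ℕ))) := by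
  have h : ∀ b c, Λ b c (X ^ t * w * (∑ x : Fin m, C (v (x, b)) * X ^ (x : ℕ)) *
        (∑ x : Fin m, C (v (x, c)) * X ^ (x : ℕ))) =
      ∑ x : Fin m, ∑ y : Fin m, v (x, b) * (a (t + x + y) b c * v (y, c)) := by
    intro b c
    rw [mul_assoc, Finset.sum_mul_sum, Finset.mul_sum, map_sum]
    refine Finset.sum_congr rfl fun x _ => ?_
    rw [Finset.mul_sum, map_sum]
    refine Finset.sum_congr rfl fun y _ => ?_
    rw [ha]
    have : X ^ t * w * (C (v (x, b)) * X ^ (x : ℕ) * (C (v (y, c)) * X ^ (y : ℕ))) =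
        (v (x, b) * v (y, c)) • (X ^ (t + x + y : ℕ) * w) := by
      rw [smul_eq_C_mul, C_mul, pow_add, pow_add]
      ring
    rw [this, map_smul, smul_eq_mul]
    ring
  simp only [h]
  simp only [dotProduct, Matrix.mulVec, Fintype.sum_prod_type, blockHankel, Matrix.of_apply,
    Pi.star_apply, star_trivial, Finset.mul_sum]
  rw [Finset.sum_comm]
  refine Finset.sum_congr rfl fun b _ => ?_
  rw [Finset.sum_comm' (t' := Finset.univ) (s' := fun _ => Finset.univ) (by simp)]
  conv_lhs => rw [Finset.sum_comm]
  conv_rhs => rw [Finset.sum_comm]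
  refine Finset.sum_congr rfl fun x _ => ?_
  rw [Finset.sum_comm]

/-- A matrix of functionals on polynomials that is strictly positive on `[0, 1]`. -/
def IsStrictlyPositive (Λ : Fin p → Fin p → ℝ[X] →ₗ[ℝ] ℝ) : Prop :=
  ∀ (w : ℝ[X]) (g : Fin p → ℝ[X]), (∀ x ∈ Set.Icc (0 : ℝ) 1, 0 ≤ w.eval x) → w ≠ 0 → g ≠ 0 →
    0 < ∑ b, ∑ c, Λ b c (w * g b * g c)

/-- The quadratic form at `v` is the functional applied to `X ^ t * w * g b * g c`, summed over `b`
and `c`, where the polynomials `g` have coefficient vector `v`. -/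
theorem blockHankel_posDef {Λ : Fin p → Fin p → ℝ[X] →ₗ[ℝ] ℝ} (hΛ : IsStrictlyPositive Λ)
    {w : ℝ[X]} (hw : ∀ x ∈ Set.Icc (0 : ℝ) 1, 0 ≤ w.eval x) (hw0 : w ≠ 0) {a : ℕ → Mat p}
    (hsymm : ∀ k, (a k).IsSymm) {t m : ℕ}
    (ha : ∀ x y : Fin m, ∀ b c, a (t + x + y) b c = Λ b c (X ^ (t + x + y : ℕ) * w)) :
    (blockHankel a t m).PosDef := by
  refine .of_dotProduct_mulVec_pos ?_ fun v hv => ?_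
  · rw [Matrix.IsHermitian, Matrix.conjTranspose_eq_transpose_of_trivial]
    exact blockHankel_isSymm hsymm t m
  · rw [quadraticForm_blockHankel Λ w ha v]
    refine hΛ _ _ (fun x hx => ?_) (mul_ne_zero (pow_ne_zero _ X_ne_zero) hw0) fun h => hv ?_
    · rw [eval_mul, eval_pow, eval_X]
      exact mul_nonneg (pow_nonneg hx.1 _) (hw x hx)
    · ext ⟨x, b⟩
      have := congrArg (fun q => coeff q x) (congrFun h b)
      simpa [finsetSum_coeff, coeff_X_pow, Fin.val_inj] using this

/-- Integration over `[0, 1]` with respect to Lebesgue measure. -/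
noncomputable def lebesgueFunctional : ℝ[X] →ₗ[ℝ] ℝ where
  toFun q := ∫ x in (0 : ℝ)..1, q.eval x
  map_add' q r := by
    simp only [eval_add]
    exact intervalIntegral.integral_add (q.continuous.intervalIntegrable _ _)
      (r.continuous.intervalIntegrable _ _)
  map_smul' c q := by
    simp only [eval_smul, RingHom.id_apply]
    exact intervalIntegral.integral_smul c _

theorem lebesgueFunctional_nonneg {q : ℝ[X]} (hq : ∀ x ∈ Set.Icc (0 : ℝ) 1, 0 ≤ q.eval x) :
    0 ≤ lebesgueFunctional q :=
  intervalIntegral.integral_nonneg zero_le_one hq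

theorem lebesgueFunctional_pos {q : ℝ[X]} (hq : ∀ x ∈ Set.Icc (0 : ℝ) 1, 0 ≤ q.eval x)
    (hq0 : q ≠ 0) : 0 < lebesgueFunctional q := by
  refine intervalIntegral.integral_pos zero_lt_one q.continuous.continuousOn
    (fun x hx => hq x ⟨hx.1.le, hx.2⟩) ?_
  by_contra! h
  refine hq0 (eq_zero_of_infinite_isRoot q ((Set.Icc_infinite (zero_lt_one' ℝ)).mono ?_))
  exact fun x hx => le_antisymm (h x hx) (hq x hx)

/-- The integral of a continuous function in terms of the Jordan decomposition. -/
theorem integral_signedMeasure_eq_sub (ν : SignedMeasure (Set.Icc (0 : ℝ) 1))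
    {f : Set.Icc (0 : ℝ) 1 → ℝ} (hf : Continuous f) :
    ∫ᵛ x, f x ∂<•ν = ∫ x, f x ∂ν.toJordanDecomposition.posPart -
      ∫ x, f x ∂ν.toJordanDecomposition.negPart := by
  have hi : ∀ (m : Measure (Set.Icc (0 : ℝ) 1)) [IsFiniteMeasure m],
      m.toSignedMeasure.Integrable f := by
    intro m _
    change Integrable f m.toSignedMeasure.variation
    rw [Measure.variation_toSignedMeasure]
    exact (BoundedContinuousFunction.mkOfCompact ⟨f, hf⟩).integrable m
  conv_lhs => rw [← ν.toSignedMeasure_toJordanDecomposition]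
  rw [JordanDecomposition.toSignedMeasure, VectorMeasure.integral_sub_vectorMeasure
    (hi _) (hi _)]
  simp

theorem signedMeasure_apply_eq_sub (ν : SignedMeasure (Set.Icc (0 : ℝ) 1))
    {A : Set (Set.Icc (0 : ℝ) 1)} (hA : MeasurableSet A) :
    ν A = ν.toJordanDecomposition.posPart.real A - ν.toJordanDecomposition.negPart.real A := by
  conv_lhs => rw [← ν.toSignedMeasure_toJordanDecomposition]
  rw [JordanDecomposition.toSignedMeasure, sub_apply,
    Measure.toSignedMeasure_apply_measurable hA, Measure.toSignedMeasure_apply_measurable hA]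

/-- Integration of a polynomial against a signed measure. -/
noncomputable def signedFunctional (ν : SignedMeasure (Set.Icc (0 : ℝ) 1)) : ℝ[X] →ₗ[ℝ] ℝ where
  toFun q := ∫ᵛ x, q.eval (x : ℝ) ∂<•ν
  map_add' q r := by
    have hc : ∀ q : ℝ[X], Continuous fun x : Set.Icc (0 : ℝ) 1 => q.eval (x : ℝ) :=
      fun q => q.continuous.comp continuous_subtype_val
    have hi : ∀ (q : ℝ[X]) (m : Measure (Set.Icc (0 : ℝ) 1)) [IsFiniteMeasure m],
        Integrable (fun x : Set.Icc (0 : ℝ) 1 => q.eval (x : ℝ)) m := fun q m _ =>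
      (BoundedContinuousFunction.mkOfCompact ⟨_, hc q⟩).integrable m
    rw [integral_signedMeasure_eq_sub _ (hc _), integral_signedMeasure_eq_sub _ (hc _),
      integral_signedMeasure_eq_sub _ (hc _)]
    simp only [eval_add]
    rw [integral_add (hi _ _) (hi _ _), integral_add (hi _ _) (hi _ _)]
    ring
  map_smul' c q := by
    simp only [eval_smul, RingHom.id_apply]
    exact VectorMeasure.integral_fun_smul ..

/-- Finite-range approximations of the identity of `[0, 1]`. -/
noncomputable def simpleId (N : ℕ) : SimpleFunc (Set.Icc (0 : ℝ) 1) (Set.Icc (0 : ℝ) 1) :=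
  SimpleFunc.approxOn id measurable_id Set.univ 0 (Set.mem_univ _) N

theorem tendsto_simpleId (x : Set.Icc (0 : ℝ) 1) :
    Tendsto (fun N => simpleId N x) atTop (𝓝 x) :=
  SimpleFunc.tendsto_approxOn (f := id) measurable_id (Set.mem_univ _) (by simp)

theorem tendsto_sum_simpleId (ν : SignedMeasure (Set.Icc (0 : ℝ) 1))
    {f : Set.Icc (0 : ℝ) 1 → ℝ} (hf : Continuous f) :
    Tendsto (fun N => ∑ r ∈ (simpleId N).range, ν (simpleId N ⁻¹' {r}) * f r) atTop
      (𝓝 (∫ᵛ x, f x ∂<•ν)) := by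
  have h : ∀ (m : Measure (Set.Icc (0 : ℝ) 1)) [IsFiniteMeasure m],
      Tendsto (fun N => ∑ r ∈ (simpleId N).range, m.real (simpleId N ⁻¹' {r}) * f r) atTop
        (𝓝 (∫ x, f x ∂m)) := by
    intro m _
    have h1 : ∀ N, ∑ r ∈ (simpleId N).range, m.real (simpleId N ⁻¹' {r}) * f r =
        ∫ x, f (simpleId N x) ∂m := by
      intro N
      have h2 : ∀ x, f (simpleId N x) = ∑ r ∈ (simpleId N).range,
          (simpleId N ⁻¹' {r}).indicator (fun _ => f r) x := by
        intro x
        rw [Finset.sum_eq_single (simpleId N x)]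
        · simp
        · intro r _ hr
          simp [hr.symm]
        · intro hx
          exact absurd ((simpleId N).mem_range_self x) hx
      simp only [h2]
      rw [integral_finsetSum _ fun r _ =>
        (integrable_const _).indicator ((simpleId N).measurableSet_fiber r)]
      exact Finset.sum_congr rfl fun r _ =>
        (integral_indicator_const _ ((simpleId N).measurableSet_fiber r)).symm
    simp only [h1]
    obtain ⟨B, hB⟩ := (isCompact_range hf).isBounded.exists_norm_le
    refine tendsto_integral_of_dominated_convergence (fun _ => B) (fun N => ?_)
      (integrable_const _) (fun N => ae_of_all _ fun x => hB _ ⟨_, rfl⟩)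
      (ae_of_all _ fun x => (hf.tendsto x).comp (tendsto_simpleId x))
    exact (hf.measurable.comp (simpleId N).measurable).aestronglyMeasurable
  rw [integral_signedMeasure_eq_sub ν hf]
  convert (h ν.toJordanDecomposition.posPart).sub (h ν.toJordanDecomposition.negPart) using 2
  rw [← Finset.sum_sub_distrib]
  refine Finset.sum_congr rfl fun r _ => ?_
  rw [signedMeasure_apply_eq_sub ν ((simpleId _).measurableSet_fiber r), sub_mul]

/-- The integrals are limits of sums of `w(r) g(r)ᵀ μ(A_r) g(r)` over finite partitions, and each
term is nonnegative because `μ(A_r)` is positive semidefinite. -/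
theorem MatrixMeasure.sum_integral_nonneg (μ : MatrixMeasure p) {w : ℝ[X]} (g : Fin p → ℝ[X])
    (hw : ∀ x ∈ Set.Icc (0 : ℝ) 1, 0 ≤ w.eval x) :
    0 ≤ ∑ b, ∑ c, signedFunctional (μ.entry b c) (w * g b * g c) := by
  have h : ∀ b c, Tendsto (fun N => ∑ r ∈ (simpleId N).range,
      μ.entry b c (simpleId N ⁻¹' {r}) * (w * g b * g c).eval (r : ℝ)) atTop
      (𝓝 (signedFunctional (μ.entry b c) (w * g b * g c))) := fun b c =>
    tendsto_sum_simpleId _ ((w * g b * g c).continuous.comp continuous_subtype_val)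
  refine ge_of_tendsto' (tendsto_finsetSum _ fun b _ => tendsto_finsetSum _ fun c _ => h b c)
    fun N => ?_
  have e : ∑ b, ∑ c, ∑ r ∈ (simpleId N).range,
      μ.entry b c (simpleId N ⁻¹' {r}) * (w * g b * g c).eval (r : ℝ) =
      ∑ r ∈ (simpleId N).range, w.eval (r : ℝ) * (star (fun b => (g b).eval (r : ℝ)) ⬝ᵥ
        Matrix.mulVec (Matrix.of fun b c => μ.entry b c (simpleId N ⁻¹' {r}))
          fun b => (g b).eval (r : ℝ)) := by
    simp only [dotProduct, Matrix.mulVec, Matrix.of_apply, Pi.star_apply, star_trivial,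
      Finset.mul_sum, eval_mul]
    conv_rhs => rw [Finset.sum_comm]
    refine Finset.sum_congr rfl fun b _ => ?_
    conv_rhs => rw [Finset.sum_comm]
    refine Finset.sum_congr rfl fun c _ => Finset.sum_congr rfl fun r _ => ?_
    ring
  rw [e]
  exact Finset.sum_nonneg fun r _ => mul_nonneg (hw _ r.2)
    ((μ.posSemidef _ ((simpleId N).measurableSet_fiber r)).dotProduct_mulVec_nonneg _)

theorem MatrixMeasure.moment_apply (μ : MatrixMeasure p) (k : ℕ) (b c : Fin p) :
    μ.moment k b c = signedFunctional (μ.entry b c) (X ^ k) := by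
  simp [MatrixMeasure.moment, signedFunctional]

theorem MatrixMeasure.moment_zero (μ : MatrixMeasure p) : μ.moment 0 = 1 := by
  rw [← μ.normalized]
  ext b c
  simp only [MatrixMeasure.moment, Matrix.of_apply, pow_zero]
  rw [integral_signedMeasure_eq_sub _ continuous_const, signedMeasure_apply_eq_sub _ .univ]
  simp

/-- A mixture of a matrix measure with Lebesgue measure times the identity. -/
noncomputable def mixedFunctional (μ : MatrixMeasure p) (ε : ℝ) (b c : Fin p) : ℝ[X] →ₗ[ℝ] ℝ :=
  (1 - ε) • signedFunctional (μ.entry b c) + (ε * (1 : Mat p) b c) • lebesgueFunctional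

theorem mixedFunctional_isStrictlyPositive (μ : MatrixMeasure p) {ε : ℝ} (h0 : 0 < ε)
    (h1 : ε ≤ 1) : IsStrictlyPositive (mixedFunctional μ ε) := by
  intro w g hw hw0 hg
  have e : ∑ b, ∑ c, mixedFunctional μ ε b c (w * g b * g c) =
      (1 - ε) * ∑ b, ∑ c, signedFunctional (μ.entry b c) (w * g b * g c) +
        ε * ∑ b, lebesgueFunctional (w * g b * g b) := by
    simp only [mixedFunctional, LinearMap.add_apply, LinearMap.smul_apply, smul_eq_mul,
      Finset.sum_add_distrib, Finset.mul_sum]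
    simp [Matrix.one_apply]
  have hnn : ∀ b, ∀ x ∈ Set.Icc (0 : ℝ) 1, 0 ≤ (w * g b * g b).eval x := by
    intro b x hx
    rw [mul_assoc, eval_mul, eval_mul]
    exact mul_nonneg (hw x hx) (mul_self_nonneg _)
  rw [e]
  refine add_pos_of_nonneg_of_pos
    (mul_nonneg (sub_nonneg.2 h1) (μ.sum_integral_nonneg g hw)) (mul_pos h0 ?_)
  obtain ⟨b, hb⟩ := Function.ne_iff.1 hg
  exact Finset.sum_pos' (fun b _ => lebesgueFunctional_nonneg (hnn b)) ⟨b, Finset.mem_univ _,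
    lebesgueFunctional_pos (hnn b) (mul_ne_zero (mul_ne_zero hw0 hb) hb)⟩

theorem exists_pullback_mem_momentSpace {n : ℕ} {s s₀ : Fin n → SymMat p}
    (hs : s ∈ interior (momentSpace p n)) :
    ∃ ε : ℝ, 0 < ε ∧ ε < 1 ∧ ∃ s' ∈ momentSpace p n, ∀ j,
      (s j : Mat p) = (1 - ε) • (s' j : Mat p) + ε • (s₀ j : Mat p) := by
  -- This solves `s = (1 - ε) s' + ε s₀` for `s'`. It is continuous at `ε = 0` with value `s`, so it
  -- stays in the moment space for small `ε > 0`.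
  let f : ℝ → Fin n → SymMat p := fun ε j =>
    ⟨(1 - ε)⁻¹ • ((s j : Mat p) - ε • (s₀ j : Mat p)), ((s j).2.sub ((s₀ j).2.smul ε)).smul _⟩
  have hf0 : f 0 = s := by
    ext j
    simp [f]
  have hf : ContinuousAt f 0 := by
    refine continuousAt_pi.2 fun j => Topology.IsInducing.subtypeVal.continuousAt_iff.2 ?_
    change ContinuousAt (fun ε : ℝ => (1 - ε)⁻¹ • ((s j : Mat p) - ε • (s₀ j : Mat p))) 0
    have : ContinuousAt (fun ε : ℝ => (1 - ε)⁻¹) 0 :=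
      (continuousAt_const.sub continuousAt_id).inv₀ (by simp)
    exact this.smul (by fun_prop)
  have hmem : ∀ᶠ ε in 𝓝 (0 : ℝ), f ε ∈ momentSpace p n := by
    refine hf.eventually ?_
    rw [hf0]
    exact mem_interior_iff_mem_nhds.1 hs
  obtain ⟨ε, h1, h2⟩ := ((hmem.filter_mono nhdsWithin_le_nhds).and
    (Ioo_mem_nhdsGT (zero_lt_one' ℝ))).exists
  refine ⟨ε, h2.1, h2.2, f ε, h1, fun j => ?_⟩
  have : (1 - ε) ≠ 0 := by linarith [h2.2]
  simp [f, smul_smul, this]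

theorem momentSeq_isSymm {n : ℕ} (s : Fin n → SymMat p) (k : ℕ) : (momentSeq s k).IsSymm := by
  cases k with
  | zero => exact Matrix.isSymm_one
  | succ k =>
    rw [momentSeq]
    split_ifs with h
    · exact (s ⟨k, h⟩).2
    · exact Matrix.isSymm_zero

theorem exists_isStrictlyPositive {n : ℕ} {s : Fin n → SymMat p}
    (hs : s ∈ interior (momentSpace p n)) :
    ∃ Λ : Fin p → Fin p → ℝ[X] →ₗ[ℝ] ℝ, IsStrictlyPositive Λ ∧
      ∀ k ≤ n, ∀ b c, momentSeq s k b c = Λ b c (X ^ k) := by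
  obtain ⟨ε, h0, h1, s', ⟨μ, hμ⟩, hs'⟩ := exists_pullback_mem_momentSpace
    (s₀ := fun j => ⟨lebesgueFunctional (X ^ (j + 1 : ℕ)) • 1, Matrix.isSymm_one.smul _⟩) hs
  refine ⟨mixedFunctional μ ε, mixedFunctional_isStrictlyPositive μ h0 h1.le, fun k hk b c => ?_⟩
  cases k with
  | zero =>
    have : lebesgueFunctional (X ^ 0) = 1 := by simp [lebesgueFunctional]
    simp only [mixedFunctional, LinearMap.add_apply, LinearMap.smul_apply, this,
      ← MatrixMeasure.moment_apply, μ.moment_zero, momentSeq, smul_eq_mul]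
    ring
  | succ k =>
    rw [momentSeq, dif_pos (show k < n by omega), hs', hμ]
    simp only [mixedFunctional, LinearMap.add_apply, LinearMap.smul_apply,
      ← MatrixMeasure.moment_apply, Matrix.add_apply, Matrix.smul_apply, smul_eq_mul]
    ring

/-- The block Hankel matrices of an interior point of the moment space are positive definite. -/
theorem blockHankel_posDef_of_mem_interior {n : ℕ} {s : Fin n → SymMat p}
    (hs : s ∈ interior (momentSpace p n)) (k : ℕ) (hk : k < n) :
    (blockHankel (momentSeq s) ((k + 1) % 2) ((k + 1) / 2 + 1)).PosDef ∧
      (blockHankel (fun j => momentSeq s j - momentSeq s (j + 1)) (k % 2) (k / 2 + 1)).PosDef := by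
  obtain ⟨Λ, hΛ, hS⟩ := exists_isStrictlyPositive hs
  constructor
  · refine blockHankel_posDef hΛ (w := 1) (by simp) one_ne_zero (momentSeq_isSymm s) ?_
    intro x y b c
    rw [mul_one, hS _ (by omega)]
  · refine blockHankel_posDef hΛ (w := 1 - X) (fun x hx => by simpa using hx.2) ?_
      (fun j => (momentSeq_isSymm s j).sub (momentSeq_isSymm s (j + 1))) ?_
    · intro h
      simpa using congrArg (eval 0) h
    · intro x y b c
      rw [mul_sub, mul_one, ← pow_succ, map_sub, ← hS _ (by omega), ← hS _ (by omega)]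
      rfl

end MatrixMoment

theorem theorem3p2 (p n : ℕ) (hn : 1 ≤ n) (s : Fin n → MatrixMoment.SymMat p)
    (hs : s ∈ interior (MatrixMoment.momentSpace p n))
    (S U ζ : ℕ → MatrixMoment.Mat p)
    (hS : S = MatrixMoment.momentSeq s)
    (hU : U = MatrixMoment.canonicalMoment S)
    (hζ : ζ = MatrixMoment.zeta U) :
    (∀ k : ℕ, 1 ≤ k → k ≤ n →
      (MatrixMoment.upperMoment S k - MatrixMoment.lowerMoment S k).PosDef) ∧
    S n = MatrixMoment.momentArray ζ n n ∧
    S n = ∑ i ∈ MatrixMoment.pathSet n, (List.ofFn fun k : Fin n => ζ (i k)).prod := by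
  subst hS hU hζ
  have hl := fun k hk => (MatrixMoment.blockHankel_posDef_of_mem_interior hs k hk).1
  have hr := fun k hk => (MatrixMoment.blockHankel_posDef_of_mem_interior hs k hk).2
  have hsymm := MatrixMoment.momentSeq_isSymm s
  have hmain := MatrixMoment.moment_eq_momentArray hsymm rfl hl hr
  refine ⟨fun k h1 hk => ?_, hmain, ?_⟩
  · obtain ⟨j, rfl⟩ := Nat.exists_eq_add_of_le' h1
    obtain ⟨e1, e2, p1, p2⟩ := MatrixMoment.gaps_of_posDef hsymm hl hr j hk
    -- The width `S_k⁺ - S_k⁻` is the sum of the two gaps.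
    have := p1.add p2
    rw [e1, e2] at this
    convert this using 1
    abel
  · rw [← MatrixMoment.momentArray_self_eq_sum_pathSet]
    exact hmain
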